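/- Fix a ground field $\mathbb{k}$. A graded vector space is a family $(A_n)_{n\ge 0}$ of $\mathbb{k}$-vector spaces, with $(A\otimes B)_n=\bigoplus_{p+q=n}A_p\otimes B_q$ (no signs in the symmetry). An $\mathbb{S}$-module is a graded vector space $M=(M(n))_{n\ge 0}$ with a linear right action of the symmetric group $S_n$ on each $M(n)$; $\mathcal{O}(M)$ denotes its underlying graded vector space. For $\mathbb{S}$-modules $M,N$ one has $(M\otimes N)(n)=\bigoplus_{p+q=n}(M(p)\otimes N(q))\otimes_{\mathbb{k}[S_p\times S_q]}\mathbb{k}[S_n]$, so that $(N^{\otimes k})(n)$ is spanned by the elements $n_1\otimes\dots\otimes n_k\otimes(T_1,\dots,T_k)$ with $n_i\in N(l_i)$, $l_1+\dots+l_k=n$, and $(T_1,\dots,T_k)$ an ordered partition of $\{1,\dots,n\}$ (possibly with empty blocks) such that $|T_i|=l_i$; one writes $n_1\otimes\dots\otimes n_k$ for the element whose $T_i$ are the consecutive intervals of lengths $l_1,\dots,l_k$. For an $\mathbb{S}$-module $P$, put $F_P(N)=P\circ N=\bigoplus_k P(k)\otimes_{S_k}N^{\otimes k}$ for an $\mathbb{S}$-module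 $N$, and $F^g_P(A)=\bigoplus_k P(k)\otimes_{S_k}A^{\otimes k}$ for a graded vector space $A$, where $S_k$ permutes the factors (in the first case together with the blocks $T_i$). An operad is a monoid $(\mathcal{P},\mu_{\mathcal P},\eta_{\mathcal P})$ in $\mathbb{S}$-modules for $\circ$; then $F_{\mathcal P}$ and $F^g_{\mathcal P}$ are monads, and a $\mathcal{P}$-algebra in $\mathbb{S}$-modules (resp. in graded vector spaces) is an algebra over the monad $F_{\mathcal P}$ (resp. $F^g_{\mathcal P}$). For $\mathbb{S}$-modules $P$ and $N$ let $$\psi_P(N)\colon F^g_P(\mathcal{O}(N))\to\mathcal{O}(F_P(N)),\qquad p\otimes n_1\otimes\dots\otimes n_k\mapsto\sum_{(T_1,\dots,T_k)}p\otimes n_1\otimes\dots\otimes n_k\otimes(T_1,\dots,T_k),$$ where $n_i\in N(l_i)$ and the sum is over all ordered partitions $(T_1,\dots,T_k)$ of $\{1,\dots,l_1+\dots+l_k\}$ with $|T_i|=l_i$. **Theorem.** Let $\mathcal{P}$ be an operad and let $M$ be a $\mathcal{P}$-algebra in $\mathbb{S}$-modules, with product $\mu_M\colon F_{\mathcal P}(M)\to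 M$. Then the graded vector space $\mathcal{O}(M)$ is a $\mathcal{P}$-algebra in graded vector spaces for the product $$\hat\mu_{\mathcal{O}(M)}\colon F^g_{\mathcal P}(\mathcal{O}(M))\xrightarrow{\ \psi_{\mathcal P}(M)\ }\mathcal{O}(F_{\mathcal P}(M))\xrightarrow{\ \mathcal{O}(\mu_M)\ }\mathcal{O}(M).$$ Moreover, for all $p\in\mathcal{P}(n)$ and $m_i\in M(l_i)$, $$\hat\mu_{\mathcal{O}(M)}(p\otimes m_1\otimes\dots\otimes m_n)=\mu_M(p\otimes m_1\otimes\dots\otimes m_n)\cdot q_{l_1,\dots,l_n},$$ where $q_{l_1,\dots,l_n}\in\mathbb{k}[S_{l_1+\dots+l_n}]$ is the sum of all $(l_1,\dots,l_n)$-shuffles, that is, of all permutations whose inverse is increasing on each of the consecutive intervals of lengths $l_1,\dots,l_n$. -/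

import Mathlib

open scoped TensorProduct DirectSum

universe u v w

/-! ## Graded vector spaces and symmetric sequences -/

/-- A graded vector space: a family of vector spaces indexed by the non-negative integers. -/
structure GrVect (𝕜 : Type u) [Field 𝕜] where
  obj : ℕ → Type v
  [addCommGroup : ∀ n, AddCommGroup (obj n)]
  [module : ∀ n, Module 𝕜 (obj n)]

attribute [instance] GrVect.addCommGroup GrVect.module

/-- A morphism of graded vector spaces: one linear map in each degree. -/
abbrev GrVect.Hom {𝕜 : Type u} [Field 𝕜] (A : GrVect.{u, v} 𝕜) (B : GrVect.{u, w} 𝕜) :=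
  ∀ n, A.obj n →ₗ[𝕜] B.obj n

/-- An `S`-module: a graded vector space with, for each `n`, a linear right action of the symmetric
group on `n` letters, that is, a representation of the opposite group. The underlying graded vector
space `M.toGrVect` is the value at `M` of the forgetful functor `O`. -/
structure SMod (𝕜 : Type u) [Field 𝕜] extends GrVect.{u, v} 𝕜 where
  ρ : ∀ n, Representation 𝕜 (Equiv.Perm (Fin n))ᵐᵒᵖ (obj n)

/-- The right action `x · σ` of a permutation on an `S`-module. -/
def SMod.act {𝕜 : Type u} [Field 𝕜] (M : SMod.{u, v} 𝕜) {n : ℕ} (σ : Equiv.Perm (Fin n)) :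
    M.obj n →ₗ[𝕜] M.obj n :=
  M.ρ n (MulOpposite.op σ)

/-- A morphism of `S`-modules: a degreewise linear map that commutes with the right actions. -/
structure SMod.Hom {𝕜 : Type u} [Field 𝕜] (M : SMod.{u, v} 𝕜) (N : SMod.{u, w} 𝕜) where
  toFun : GrVect.Hom M.toGrVect N.toGrVect
  equivariant : ∀ (n : ℕ) (σ : Equiv.Perm (Fin n)) (x : M.obj n),
    toFun n (M.act σ x) = N.act σ (toFun n x)

/-! ## The plethysm of `S`-modules

`(P ∘ N)(n) = ⨁ₖ P(k) ⊗_{S_k} (N^{⊗ k})(n)`, where `(N^{⊗ k})(n)` is the direct sum over all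
`l : Fin k → ℕ` with `l₁ + … + l_k = n` of the induced modules
`(N(l₁) ⊗ … ⊗ N(l_k)) ⊗_{S_{l₁} × … × S_{l_k}} 𝕜[S_n]`.

The basis `S_n` of `𝕜[S_n]` is written as the set of bijections from `Fin n` to the disjoint union
of the `Fin (l i)` (which is empty unless `l₁ + … + l_k = n`): on it `S_n` acts on the right by
precomposition, and `S_{l₁} × … × S_{l_k}` on the left by postcomposition. -/

/-- Indices of the summands: the arity `k`, the degrees `l₁, …, l_k`, and a bijection `e`. -/
abbrev PlethIdx (n : ℕ) :=
  Σ k : ℕ, Σ l : Fin k → ℕ, (Fin n ≃ Σ i, Fin (l i))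

/-- The direct sum of the `P(k) ⊗ N(l₁) ⊗ … ⊗ N(l_k)`, before the tensor products over the group
algebras are formed. -/
abbrev PrePleth {𝕜 : Type u} [Field 𝕜] (P : SMod.{u, v} 𝕜) (N : SMod.{u, w} 𝕜) (n : ℕ) :=
  ⨁ x : PlethIdx n, P.obj x.1 ⊗[𝕜] (⨂[𝕜] i, N.obj (x.2.1 i))

/-- The generator `p ⊗ m₁ ⊗ … ⊗ m_k ⊗ e`. -/
noncomputable def PrePleth.gen {𝕜 : Type u} [Field 𝕜] {P : SMod.{u, v} 𝕜} {N : SMod.{u, w} 𝕜}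
    {n k : ℕ} (l : Fin k → ℕ) (e : Fin n ≃ Σ i, Fin (l i)) (p : P.obj k)
    (m : ∀ i, N.obj (l i)) : PrePleth P N n :=
  DirectSum.lof 𝕜 (PlethIdx n) (fun x => P.obj x.1 ⊗[𝕜] (⨂[𝕜] i, N.obj (x.2.1 i))) ⟨k, l, e⟩
    (p ⊗ₜ[𝕜] PiTensorProduct.tprod 𝕜 m)

/-- The relations of the two tensor products over group algebras:
* over `S_{l₁} × … × S_{l_k}`:
  `p ⊗ m₁·σ₁ ⊗ … ⊗ m_k·σ_k ⊗ e = p ⊗ m₁ ⊗ … ⊗ m_k ⊗ (σ₁ × … × σ_k) e`;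
* over `S_k`: `p·σ ⊗ x = p ⊗ σ x`, where `σ` permutes the factors of `x` together with the blocks
  of the bijection: the factor in position `i` of `x` is the factor in position `σ i` of `σ x`. -/
noncomputable def plethRel {𝕜 : Type u} [Field 𝕜] (P : SMod.{u, v} 𝕜) (N : SMod.{u, w} 𝕜) (n : ℕ) :
    Submodule 𝕜 (PrePleth P N n) :=
  Submodule.span 𝕜
    ({z | ∃ (k : ℕ) (l : Fin k → ℕ) (e : Fin n ≃ Σ i, Fin (l i)) (p : P.obj k)
          (m : ∀ i, N.obj (l i)) (σ : ∀ i, Equiv.Perm (Fin (l i))),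
        z = PrePleth.gen l e p (fun i => N.act (σ i) (m i))
          - PrePleth.gen l (e.trans (Equiv.sigmaCongrRight σ)) p m} ∪
     {z | ∃ (k : ℕ) (l : Fin k → ℕ) (e : Fin n ≃ Σ i, Fin (l i)) (p : P.obj k)
          (m : ∀ i, N.obj (l i)) (σ : Equiv.Perm (Fin k)),
        z = PrePleth.gen (fun i => l (σ i))
              (e.trans (Equiv.sigmaCongrLeft (β := fun i => Fin (l i)) σ).symm)
              (P.act σ p) (fun i => m (σ i))
          - PrePleth.gen l e p m})

/-- The vector space `(P ∘ N)(n)`. -/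
abbrev PlethObj {𝕜 : Type u} [Field 𝕜] (P : SMod.{u, v} 𝕜) (N : SMod.{u, w} 𝕜) (n : ℕ) :=
  PrePleth P N n ⧸ plethRel P N n

/-- The class of `p ⊗ m₁ ⊗ … ⊗ m_k ⊗ e` in `(P ∘ N)(n)`. -/
noncomputable def PlethObj.mk {𝕜 : Type u} [Field 𝕜] {P : SMod.{u, v} 𝕜} {N : SMod.{u, w} 𝕜}
    {n k : ℕ} (l : Fin k → ℕ) (e : Fin n ≃ Σ i, Fin (l i)) (p : P.obj k)
    (m : ∀ i, N.obj (l i)) : PlethObj P N n :=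
  (plethRel P N n).mkQ (PrePleth.gen l e p m)

theorem PlethObj.mk_block {𝕜 : Type u} [Field 𝕜] {P : SMod.{u, v} 𝕜} {N : SMod.{u, w} 𝕜}
    {n k : ℕ} (l : Fin k → ℕ) (e : Fin n ≃ Σ i, Fin (l i)) (p : P.obj k)
    (m : ∀ i, N.obj (l i)) (σ : ∀ i, Equiv.Perm (Fin (l i))) :
    PlethObj.mk (P := P) (N := N) l e p (fun i => N.act (σ i) (m i)) =
      PlethObj.mk l (e.trans (Equiv.sigmaCongrRight σ)) p m :=
  (Submodule.Quotient.eq _).2 (Submodule.subset_span (Or.inl ⟨k, l, e, p, m, σ, rfl⟩))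

theorem PlethObj.mk_perm {𝕜 : Type u} [Field 𝕜] {P : SMod.{u, v} 𝕜} {N : SMod.{u, w} 𝕜}
    {n k : ℕ} (l : Fin k → ℕ) (e : Fin n ≃ Σ i, Fin (l i)) (p : P.obj k)
    (m : ∀ i, N.obj (l i)) (σ : Equiv.Perm (Fin k)) :
    PlethObj.mk (P := P) (N := N) (fun i => l (σ i))
        (e.trans (Equiv.sigmaCongrLeft (β := fun i => Fin (l i)) σ).symm)
        (P.act σ p) (fun i => m (σ i)) =
      PlethObj.mk l e p m :=
  (Submodule.Quotient.eq _).2 (Submodule.subset_span (Or.inr ⟨k, l, e, p, m, σ, rfl⟩))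

/-- Two linear maps out of `(P ∘ N)(n)` agree if they agree on all generators. -/
theorem PlethObj.hom_ext {𝕜 : Type u} [Field 𝕜] {P : SMod.{u, v} 𝕜} {N : SMod.{u, w} 𝕜} {n : ℕ}
    {V : Type*} [AddCommGroup V] [Module 𝕜 V] {f g : PlethObj P N n →ₗ[𝕜] V}
    (h : ∀ (k : ℕ) (l : Fin k → ℕ) (e : Fin n ≃ Σ i, Fin (l i)) (p : P.obj k)
      (m : ∀ i, N.obj (l i)), f (PlethObj.mk l e p m) = g (PlethObj.mk l e p m)) : f = g := by
  apply Submodule.linearMap_qext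
  apply DirectSum.linearMap_ext
  rintro ⟨k, l, e⟩
  apply TensorProduct.ext
  ext p m
  exact h k l e p m

/-- Right multiplication by `τ` on the bijections `e`, before passing to the quotient. -/
noncomputable def PrePleth.act {𝕜 : Type u} [Field 𝕜] (P : SMod.{u, v} 𝕜) (N : SMod.{u, w} 𝕜)
    {n : ℕ} (τ : Equiv.Perm (Fin n)) : PrePleth P N n →ₗ[𝕜] PrePleth P N n :=
  DirectSum.toModule 𝕜 (PlethIdx n) (PrePleth P N n) fun x =>
    DirectSum.lof 𝕜 (PlethIdx n) (fun x => P.obj x.1 ⊗[𝕜] (⨂[𝕜] i, N.obj (x.2.1 i)))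
      ⟨x.1, x.2.1, τ.trans x.2.2⟩

theorem PrePleth.act_gen {𝕜 : Type u} [Field 𝕜] {P : SMod.{u, v} 𝕜} {N : SMod.{u, w} 𝕜}
    {n k : ℕ} (τ : Equiv.Perm (Fin n)) (l : Fin k → ℕ) (e : Fin n ≃ Σ i, Fin (l i)) (p : P.obj k)
    (m : ∀ i, N.obj (l i)) :
    PrePleth.act P N τ (PrePleth.gen l e p m) = PrePleth.gen l (τ.trans e) p m := by
  simp only [PrePleth.act, PrePleth.gen, DirectSum.toModule_lof]

theorem plethRel_le_comap_act {𝕜 : Type u} [Field 𝕜] (P : SMod.{u, v} 𝕜) (N : SMod.{u, w} 𝕜)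
    {n : ℕ} (τ : Equiv.Perm (Fin n)) :
    plethRel P N n ≤ (plethRel P N n).comap (PrePleth.act P N τ) := by
  refine Submodule.span_le.2 ?_
  rintro z (⟨k, l, e, p, m, σ, rfl⟩ | ⟨k, l, e, p, m, σ, rfl⟩)
  · refine Submodule.subset_span (Or.inl ⟨k, l, τ.trans e, p, m, σ, ?_⟩)
    rw [map_sub, PrePleth.act_gen, PrePleth.act_gen]
    rfl
  · refine Submodule.subset_span (Or.inr ⟨k, l, τ.trans e, p, m, σ, ?_⟩)
    rw [map_sub, PrePleth.act_gen, PrePleth.act_gen]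
    rfl

/-- The right action of `S_n` on `(P ∘ N)(n)`. -/
noncomputable def PlethObj.act {𝕜 : Type u} [Field 𝕜] (P : SMod.{u, v} 𝕜) (N : SMod.{u, w} 𝕜)
    {n : ℕ} (τ : Equiv.Perm (Fin n)) : PlethObj P N n →ₗ[𝕜] PlethObj P N n :=
  (plethRel P N n).mapQ (plethRel P N n) (PrePleth.act P N τ) (plethRel_le_comap_act P N τ)

theorem PlethObj.act_mk {𝕜 : Type u} [Field 𝕜] {P : SMod.{u, v} 𝕜} {N : SMod.{u, w} 𝕜}
    {n k : ℕ} (τ : Equiv.Perm (Fin n)) (l : Fin k → ℕ) (e : Fin n ≃ Σ i, Fin (l i)) (p : P.obj k)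
    (m : ∀ i, N.obj (l i)) :
    PlethObj.act P N τ (PlethObj.mk l e p m) = PlethObj.mk l (τ.trans e) p m := by
  simp only [PlethObj.act, PlethObj.mk, Submodule.mkQ_apply, Submodule.mapQ_apply,
    PrePleth.act_gen]

/-- The plethysm `P ∘ N = F_P(N)` of two `S`-modules. -/
noncomputable def SMod.pleth {𝕜 : Type u} [Field 𝕜] (P : SMod.{u, v} 𝕜) (N : SMod.{u, w} 𝕜) :
    SMod.{u, max u v w} 𝕜 where
  obj n := PlethObj P N n
  ρ n :=
    { toFun := fun τ => PlethObj.act P N τ.unop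
      map_one' := by
        apply PlethObj.hom_ext
        intro k l e p m
        rw [PlethObj.act_mk]
        rfl
      map_mul' := by
        intro τ τ'
        apply PlethObj.hom_ext
        intro k l e p m
        rw [Module.End.mul_apply, PlethObj.act_mk, PlethObj.act_mk, PlethObj.act_mk]
        rfl }

/-! ## The plethysm of an `S`-module with a graded vector space

`(P ∘ A)(n) = ⨁ₖ P(k) ⊗_{S_k} (A^{⊗ k})(n)`, where
`(A^{⊗ k})(n)` is the direct sum of the `A(l₁) ⊗ … ⊗ A(l_k)` with `l₁ + … + l_k = n`. -/

/-- Indices of the summands: the arity `k` and degrees `l₁, …, l_k` of sum `n`. -/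
abbrev GrPlethIdx (n : ℕ) :=
  Σ k : ℕ, {l : Fin k → ℕ // ∑ i, l i = n}

/-- The direct sum of the `P(k) ⊗ A(l₁) ⊗ … ⊗ A(l_k)`, before the tensor product over `𝕜[S_k]` is
formed. -/
abbrev PreGrPleth {𝕜 : Type u} [Field 𝕜] (P : SMod.{u, v} 𝕜) (A : GrVect.{u, w} 𝕜) (n : ℕ) :=
  ⨁ x : GrPlethIdx n, P.obj x.1 ⊗[𝕜] (⨂[𝕜] i, A.obj (x.2.1 i))

/-- The generator `p ⊗ a₁ ⊗ … ⊗ a_k`. -/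
noncomputable def PreGrPleth.gen {𝕜 : Type u} [Field 𝕜] {P : SMod.{u, v} 𝕜} {A : GrVect.{u, w} 𝕜}
    {n k : ℕ} (l : Fin k → ℕ) (h : ∑ i, l i = n) (p : P.obj k) (a : ∀ i, A.obj (l i)) :
    PreGrPleth P A n :=
  DirectSum.lof 𝕜 (GrPlethIdx n) (fun x => P.obj x.1 ⊗[𝕜] (⨂[𝕜] i, A.obj (x.2.1 i))) ⟨k, l, h⟩
    (p ⊗ₜ[𝕜] PiTensorProduct.tprod 𝕜 a)

/-- The relations `p·σ ⊗ x = p ⊗ σ x` of the tensor product over `𝕜[S_k]`, where the factor in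
position `i` of `x` is the factor in position `σ i` of `σ x`. -/
noncomputable def grPlethRel {𝕜 : Type u} [Field 𝕜] (P : SMod.{u, v} 𝕜) (A : GrVect.{u, w} 𝕜)
    (n : ℕ) : Submodule 𝕜 (PreGrPleth P A n) :=
  Submodule.span 𝕜
    {z | ∃ (k : ℕ) (l : Fin k → ℕ) (h : ∑ i, l i = n) (p : P.obj k)
          (a : ∀ i, A.obj (l i)) (σ : Equiv.Perm (Fin k)),
        z = PreGrPleth.gen (fun i => l (σ i)) ((Equiv.sum_comp σ l).trans h)
              (P.act σ p) (fun i => a (σ i))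
          - PreGrPleth.gen l h p a}

/-- The vector space `(P ∘ A)(n)`. -/
abbrev GrPlethObj {𝕜 : Type u} [Field 𝕜] (P : SMod.{u, v} 𝕜) (A : GrVect.{u, w} 𝕜) (n : ℕ) :=
  PreGrPleth P A n ⧸ grPlethRel P A n

/-- The class of `p ⊗ a₁ ⊗ … ⊗ a_k` in `(P ∘ A)(n)`. -/
noncomputable def GrPlethObj.mk {𝕜 : Type u} [Field 𝕜] {P : SMod.{u, v} 𝕜} {A : GrVect.{u, w} 𝕜}
    {n k : ℕ} (l : Fin k → ℕ) (h : ∑ i, l i = n) (p : P.obj k) (a : ∀ i, A.obj (l i)) :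
    GrPlethObj P A n :=
  (grPlethRel P A n).mkQ (PreGrPleth.gen l h p a)

/-- The plethysm `P ∘ A = F^g_P(A)` of an `S`-module with a graded vector space. -/
noncomputable def SMod.grPleth {𝕜 : Type u} [Field 𝕜] (P : SMod.{u, v} 𝕜) (A : GrVect.{u, w} 𝕜) :
    GrVect.{u, max u v w} 𝕜 where
  obj n := GrPlethObj P A n

/-! ## Operads and their algebras

The associativity and unit diagrams are written out on generators, which span the plethysms. -/

/-- For bijections `e₀ : Fin n ≃ Σ i, Fin (a i)`, `e i : Fin (L i) ≃ Σ j, Fin (l i j)` and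
`E : Fin d ≃ Σ i, Fin (L i)`, the bijection obtained by refining each block of `E` according to
`e i`, the small blocks being listed in the order given by `e₀`. -/
def refineEquiv {k n d : ℕ} {a : Fin k → ℕ} {L : Fin k → ℕ} {l : ∀ i, Fin (a i) → ℕ}
    (e₀ : Fin n ≃ Σ i, Fin (a i)) (e : ∀ i, Fin (L i) ≃ Σ j, Fin (l i j))
    (E : Fin d ≃ Σ i, Fin (L i)) : Fin d ≃ Σ t : Fin n, Fin (l (e₀ t).1 (e₀ t).2) :=
  ((E.trans (Equiv.sigmaCongrRight e)).trans
    (Equiv.sigmaAssoc fun i (j : Fin (a i)) => Fin (l i j)).symm).trans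
    (Equiv.sigmaCongrLeft (β := fun x : Σ i, Fin (a i) => Fin (l x.1 x.2)) e₀).symm

/-- Associativity of a left action `act : P ∘ M → M` with respect to `mul : P ∘ P → P`:
`p(q₁(m₁₁, …), …, q_k(m_k₁, …)) = (p(q₁, …, q_k))(m₁₁, …)`, that is, the two composites
`P ∘ P ∘ M → M` agree. -/
def SMod.ActAssoc {𝕜 : Type u} [Field 𝕜] {P : SMod.{u, v} 𝕜} {M : SMod.{u, w} 𝕜}
    (mul : SMod.Hom (P.pleth P) P) (act : SMod.Hom (P.pleth M) M) : Prop :=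
  ∀ (k n d : ℕ) (a : Fin k → ℕ) (L : Fin k → ℕ) (l : ∀ i, Fin (a i) → ℕ)
    (e₀ : Fin n ≃ Σ i, Fin (a i)) (e : ∀ i, Fin (L i) ≃ Σ j, Fin (l i j))
    (E : Fin d ≃ Σ i, Fin (L i))
    (p : P.obj k) (q : ∀ i, P.obj (a i)) (m : ∀ i j, M.obj (l i j)),
    act.toFun d (PlethObj.mk L E p fun i => act.toFun (L i) (PlethObj.mk (l i) (e i) (q i) (m i))) =
      act.toFun d (PlethObj.mk (fun t => l (e₀ t).1 (e₀ t).2) (refineEquiv e₀ e E)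
        (mul.toFun n (PlethObj.mk a e₀ p q)) fun t => m (e₀ t).1 (e₀ t).2)

/-- Unitality of a left action `P ∘ M → M`: `1(m) = m`. -/
def SMod.ActUnit {𝕜 : Type u} [Field 𝕜] {P : SMod.{u, v} 𝕜} {M : SMod.{u, w} 𝕜}
    (one : P.obj 1) (act : SMod.Hom (P.pleth M) M) : Prop :=
  ∀ (n : ℕ) (m : M.obj n),
    act.toFun n (PlethObj.mk (fun _ : Fin 1 => n)
      (Equiv.uniqueSigma fun _ : Fin 1 => Fin n).symm one fun _ => m) = m

/-- An operad: a monoid in `S`-modules for the plethysm. The unit `I → P`, where `I` is the ground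
field concentrated in degree `1`, is given by the image `one` of `1`. -/
structure Operad (𝕜 : Type u) [Field 𝕜] extends SMod.{u, v} 𝕜 where
  mul : SMod.Hom (toSMod.pleth toSMod) toSMod
  one : toSMod.obj 1
  mul_assoc : SMod.ActAssoc mul mul
  one_mul : SMod.ActUnit one mul
  mul_one : ∀ (n : ℕ) (p : toSMod.obj n),
    mul.toFun n (PlethObj.mk (fun _ : Fin n => 1)
      (Equiv.sigmaUnique (Fin n) fun _ => Fin 1).symm p fun _ => one) = p

/-- `μ : F_P(M) → M` makes the `S`-module `M` an algebra over the operad `P`. -/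
structure Operad.IsSAlgebra {𝕜 : Type u} [Field 𝕜] (P : Operad.{u, v} 𝕜) (M : SMod.{u, w} 𝕜)
    (μ : SMod.Hom (P.toSMod.pleth M) M) : Prop where
  assoc : SMod.ActAssoc P.mul μ
  unit : SMod.ActUnit P.one μ

/-- `μ : F^g_P(A) → A` makes the graded vector space `A` an algebra over the operad `P`. -/
structure Operad.IsGrAlgebra {𝕜 : Type u} [Field 𝕜] (P : Operad.{u, v} 𝕜) (A : GrVect.{u, w} 𝕜)
    (μ : GrVect.Hom (P.toSMod.grPleth A) A) : Prop where
  assoc : ∀ (k n d : ℕ) (a : Fin k → ℕ) (L : Fin k → ℕ) (l : ∀ i, Fin (a i) → ℕ)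
    (e₀ : Fin n ≃ Σ i, Fin (a i)) (h : ∀ i, ∑ j, l i j = L i) (H : ∑ i, L i = d)
    (H' : ∑ t : Fin n, l (e₀ t).1 (e₀ t).2 = d)
    (p : P.obj k) (q : ∀ i, P.obj (a i)) (x : ∀ i j, A.obj (l i j)),
    μ d (GrPlethObj.mk L H p fun i => μ (L i) (GrPlethObj.mk (l i) (h i) (q i) (x i))) =
      μ d (GrPlethObj.mk (fun t => l (e₀ t).1 (e₀ t).2) H'
        (P.mul.toFun n (PlethObj.mk a e₀ p q)) fun t => x (e₀ t).1 (e₀ t).2)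
  unit : ∀ (n : ℕ) (x : A.obj n),
    μ n (GrPlethObj.mk (fun _ : Fin 1 => n) (Fin.sum_univ_one _) P.one fun _ => x) = x

/-! ## Shuffles and the transformation `ψ` -/

/-- A bijection `e` from `Fin n` to the disjoint union of the `Fin (l i)` whose inverse is
increasing on each block. It is the same thing as the ordered partition `(T₁, …, T_k)` of `Fin n`
with `|T_i| = l i`, where `T_i` is the preimage of the block `i`. -/
def IsShuffle {n k : ℕ} {l : Fin k → ℕ} (e : Fin n ≃ Σ i, Fin (l i)) : Prop :=
  ∀ i, StrictMono fun j : Fin (l i) => e.symm ⟨i, j⟩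

/-- The identification of `Fin (l₁ + … + l_k)` with the disjoint union of the consecutive
blocks of lengths `l₁, …, l_k`. -/
def blocks {k : ℕ} (l : Fin k → ℕ) : Fin (∑ i, l i) ≃ Σ i, Fin (l i) :=
  finSigmaFinEquiv.symm

open Classical in
/-- The sum `q_{l₁, …, l_k}` of all `(l₁, …, l_k)`-shuffles, that is of all permutations of
`l₁ + … + l_k` letters whose inverse is increasing on each of the consecutive blocks of lengths
`l₁, …, l_k`, in the algebra that acts on the right. -/
noncomputable def shuffleSum (𝕜 : Type u) [Field 𝕜] {k : ℕ} (l : Fin k → ℕ) :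
    MonoidAlgebra 𝕜 (Equiv.Perm (Fin (∑ i, l i)))ᵐᵒᵖ :=
  ∑ τ : Equiv.Perm (Fin (∑ i, l i)) with IsShuffle (τ.trans (blocks l)),
    MonoidAlgebra.of 𝕜 _ (MulOpposite.op τ)

open Classical in
/-- `p ⊗ m₁ ⊗ … ⊗ m_k ↦ ∑ p ⊗ m₁ ⊗ … ⊗ m_k ⊗ (T₁, …, T_k)`, before passing to the quotient. -/
noncomputable def prePsi {𝕜 : Type u} [Field 𝕜] (P : SMod.{u, v} 𝕜) (N : SMod.{u, w} 𝕜) (n : ℕ) :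
    PreGrPleth P N.toGrVect n →ₗ[𝕜] PlethObj P N n :=
  DirectSum.toModule 𝕜 (GrPlethIdx n) (PlethObj P N n) fun x =>
    ∑ e : Fin n ≃ Σ i, Fin (x.2.1 i) with IsShuffle e,
      (plethRel P N n).mkQ ∘ₗ
        DirectSum.lof 𝕜 (PlethIdx n) (fun x => P.obj x.1 ⊗[𝕜] (⨂[𝕜] i, N.obj (x.2.1 i)))
          ⟨x.1, x.2.1, e⟩

open Classical in
theorem prePsi_gen {𝕜 : Type u} [Field 𝕜] {P : SMod.{u, v} 𝕜} {N : SMod.{u, w} 𝕜} {n k : ℕ}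
    (l : Fin k → ℕ) (h : ∑ i, l i = n) (p : P.obj k) (m : ∀ i, N.obj (l i)) :
    prePsi P N n (PreGrPleth.gen (A := N.toGrVect) l h p m) =
      ∑ e : Fin n ≃ Σ i, Fin (l i) with IsShuffle e, PlethObj.mk l e p m := by
  simp only [prePsi, PreGrPleth.gen, DirectSum.toModule_lof, LinearMap.sum_apply]
  rfl

theorem grPlethRel_le_ker_prePsi {𝕜 : Type u} [Field 𝕜] (P : SMod.{u, v} 𝕜) (N : SMod.{u, w} 𝕜)
    (n : ℕ) : grPlethRel P N.toGrVect n ≤ LinearMap.ker (prePsi P N n) := by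
  classical
  refine Submodule.span_le.2 ?_
  rintro z ⟨k, l, h, p, m, σ, rfl⟩
  rw [SetLike.mem_coe, LinearMap.mem_ker, map_sub, sub_eq_zero, prePsi_gen, prePsi_gen]
  symm
  refine Finset.sum_bij
    (fun e _ => e.trans (Equiv.sigmaCongrLeft (β := fun i => Fin (l i)) σ).symm) ?_ ?_ ?_ ?_
  · intro e he
    rw [Finset.mem_filter] at he ⊢
    exact ⟨Finset.mem_univ _, fun i => he.2 (σ i)⟩
  · intro e _ e' _ hee
    ext t : 1
    exact (Equiv.sigmaCongrLeft (β := fun i => Fin (l i)) σ).symm.injective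
      (DFunLike.congr_fun hee t)
  · intro e he
    rw [Finset.mem_filter] at he
    refine ⟨e.trans (Equiv.sigmaCongrLeft (β := fun i => Fin (l i)) σ), ?_, ?_⟩
    · rw [Finset.mem_filter]
      refine ⟨Finset.mem_univ _, fun i => ?_⟩
      obtain ⟨i, rfl⟩ := σ.surjective i
      have key : ∀ j, (e.trans (Equiv.sigmaCongrLeft (β := fun i => Fin (l i)) σ)).symm ⟨σ i, j⟩ =
          e.symm ⟨i, j⟩ := by
        intro j
        rw [Equiv.symm_apply_eq, Equiv.trans_apply, Equiv.apply_symm_apply]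
        rfl
      intro j j' hj
      simp only [key]
      exact he.2 i hj
    · ext t : 1
      exact (Equiv.sigmaCongrLeft (β := fun i => Fin (l i)) σ).symm_apply_apply (e t)
  · intro e _
    exact (PlethObj.mk_perm l e p m σ).symm

/-- The transformation `ψ_P(N) : F^g_P(O(N)) → O(F_P(N))`, which sends `p ⊗ m₁ ⊗ … ⊗ m_k` to the
sum of the `p ⊗ m₁ ⊗ … ⊗ m_k ⊗ (T₁, …, T_k)` over all ordered partitions `(T₁, …, T_k)` with
`|T_i| = deg m_i`. -/
noncomputable def SMod.psi {𝕜 : Type u} [Field 𝕜] (P : SMod.{u, v} 𝕜) (N : SMod.{u, w} 𝕜) :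
    GrVect.Hom (P.grPleth N.toGrVect) (P.pleth N).toGrVect := fun n =>
  (grPlethRel P N.toGrVect n).liftQ (prePsi P N n) (grPlethRel_le_ker_prePsi P N n)

/-- The symmetrized product: the composite of `ψ_P(M) : F^g_P(O(M)) → O(F_P(M))` and
`O(μ) : O(F_P(M)) → O(M)`. -/
noncomputable def SMod.symProd {𝕜 : Type u} [Field 𝕜] {P : SMod.{u, v} 𝕜} {M : SMod.{u, w} 𝕜}
    (μ : SMod.Hom (P.pleth M) M) : GrVect.Hom (P.grPleth M.toGrVect) M.toGrVect := fun n =>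
  μ.toFun n ∘ₗ P.psi M n

/-!
The symmetrized product of `p ⊗ m₁ ⊗ … ⊗ m_k` is the sum of the products of `M` over all shuffles
`e`, that is, over all ordered partitions of the set of inputs into blocks of the prescribed sizes.

Associativity is a bijection between two sets of ordered partitions. Multiplying twice produces a
sum over a partition into large blocks together with a partition of each large block into small
blocks; multiplying once, after composing in the operad, produces a sum over the partitions into
small blocks. Refinement, `refineEquiv`, identifies the two index sets
(`sum_shuffle_refineEquiv`): the large blocks are recovered as unions of small ones, and a
shuffle is determined by its blocks, since a strictly increasing map out of a finite ordinal is
determined by its range. Associativity of `M` then matches the summands one by one.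

Unitality holds since there is only one partition into a single block, and the formula with
`shuffleSum` holds since `τ ↦ τ.trans (blocks l)` is a bijection from permutations onto the
bijections that index the summands of `(P ∘ M)(n)`, compatible with the right actions.
-/

/-! ### Shuffles -/

/-- A shuffle is determined by its ordered partition: the blocks, as sets, are the ranges of the
increasing maps `e.symm ⟨i, ·⟩`. -/
theorem IsShuffle.eq_of_fst_eq {n k : ℕ} {l : Fin k → ℕ} {e e' : Fin n ≃ Σ i, Fin (l i)}
    (he : IsShuffle e) (he' : IsShuffle e') (h : ∀ t, (e t).1 = (e' t).1) : e = e' := by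
  have range_eq (f : Fin n ≃ Σ i, Fin (l i)) (i : Fin k) :
      Set.range (fun j : Fin (l i) => f.symm ⟨i, j⟩) = {t | (f t).1 = i} := by
    ext t
    constructor
    · rintro ⟨j, rfl⟩
      simp
    · rintro rfl
      exact ⟨(f t).2, f.symm_apply_apply t⟩
  have hfun (i : Fin k) :
      (fun j : Fin (l i) => e.symm ⟨i, j⟩) = fun j : Fin (l i) => e'.symm ⟨i, j⟩ := by
    refine ((he i).range_inj (he' i)).1 ?_
    rw [range_eq, range_eq]
    ext t
    exact (h t).congr_left
  have hsymm : e.symm = e'.symm := Equiv.ext fun ⟨i, j⟩ => congrFun (hfun i) j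
  rw [← e.symm_symm, hsymm, e'.symm_symm]

/-- Every ordered partition, given by the block `f t` of each element `t`, comes from a shuffle. -/
theorem exists_isShuffle_fst_eq {n k : ℕ} {l : Fin k → ℕ} (f : Fin n → Fin k)
    (hf : ∀ i, Fintype.card {t // f t = i} = l i) :
    ∃ e : Fin n ≃ Σ i, Fin (l i), IsShuffle e ∧ ∀ t, (e t).1 = f t := by
  let u (i : Fin k) : Fin (l i) ≃o {t // f t = i} := Fintype.orderIsoFinOfCardEq _ (hf i)
  refine ⟨(Equiv.sigmaFiberEquiv f).symm.trans (Equiv.sigmaCongrRight fun i => (u i).symm.toEquiv),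
    fun i j j' hj => ?_, fun t => rfl⟩
  exact (u i).strictMono hj

section Refine

variable {k n d : ℕ} {a : Fin k → ℕ} {L : Fin k → ℕ} {l : ∀ i, Fin (a i) → ℕ}

theorem refineEquiv_symm_apply (e₀ : Fin n ≃ Σ i, Fin (a i))
    (e : ∀ i, Fin (L i) ≃ Σ j, Fin (l i j)) (E : Fin d ≃ Σ i, Fin (L i)) (t : Fin n)
    (s : Fin (l (e₀ t).1 (e₀ t).2)) :
    (refineEquiv e₀ e E).symm ⟨t, s⟩ =
      E.symm ⟨(e₀ t).1, (e (e₀ t).1).symm ⟨(e₀ t).2, s⟩⟩ :=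
  rfl

/-- The small block of the refinement that contains `E.symm x` is, in the labelling by `e₀`, a part
of the large block of `x`. -/
theorem apply_refineEquiv_symm_fst (e₀ : Fin n ≃ Σ i, Fin (a i))
    (e : ∀ i, Fin (L i) ≃ Σ j, Fin (l i j)) (E : Fin d ≃ Σ i, Fin (L i)) (x : Σ i, Fin (L i)) :
    e₀ (refineEquiv e₀ e E (E.symm x)).1 = ⟨x.1, (e x.1 x.2).1⟩ := by
  obtain ⟨i, y⟩ := x
  obtain ⟨⟨j, s⟩, rfl⟩ := (e i).symm.surjective y
  obtain ⟨t, ht⟩ := e₀.surjective ⟨i, j⟩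
  obtain rfl : (e₀ t).1 = i := by rw [ht]
  obtain rfl : (e₀ t).2 = j := eq_of_heq (Sigma.mk.inj_iff.1 ht).2
  rw [← refineEquiv_symm_apply, Equiv.apply_symm_apply, Equiv.apply_symm_apply]

theorem IsShuffle.refineEquiv (e₀ : Fin n ≃ Σ i, Fin (a i))
    {e : ∀ i, Fin (L i) ≃ Σ j, Fin (l i j)} {E : Fin d ≃ Σ i, Fin (L i)}
    (he : ∀ i, IsShuffle (e i)) (hE : IsShuffle E) : IsShuffle (refineEquiv e₀ e E) :=
  fun t _ _ h => hE (e₀ t).1 (he (e₀ t).1 (e₀ t).2 h)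

/-- The refinement determines the set of elements of each large block, hence the shuffle `E`; then
`e` is read off by cancelling `E`. -/
theorem refineEquiv_injective_of_isShuffle (e₀ : Fin n ≃ Σ i, Fin (a i))
    {e e' : ∀ i, Fin (L i) ≃ Σ j, Fin (l i j)} {E E' : Fin d ≃ Σ i, Fin (L i)}
    (hE : IsShuffle E) (hE' : IsShuffle E')
    (h : refineEquiv e₀ e E = refineEquiv e₀ e' E') : E = E' ∧ e = e' := by
  have fst_eq (e : ∀ i, Fin (L i) ≃ Σ j, Fin (l i j)) (E : Fin d ≃ Σ i, Fin (L i)) (t : Fin d) :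
      (E t).1 = (e₀ (refineEquiv e₀ e E t).1).1 := by
    have := apply_refineEquiv_symm_fst e₀ e E (E t)
    rw [Equiv.symm_apply_apply] at this
    rw [this]
  obtain rfl : E = E' := hE.eq_of_fst_eq hE' fun t => by rw [fst_eq e, fst_eq e', h]
  refine ⟨rfl, funext fun i => ?_⟩
  have hsymm : (e i).symm = (e' i).symm := by
    ext1 ⟨j, s⟩
    obtain ⟨t, ht⟩ := e₀.surjective ⟨i, j⟩
    obtain rfl : (e₀ t).1 = i := by rw [ht]
    obtain rfl : (e₀ t).2 = j := eq_of_heq (Sigma.mk.inj_iff.1 ht).2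
    have := congrArg (fun f => f.symm ⟨t, s⟩) h
    simp only [refineEquiv_symm_apply, EmbeddingLike.apply_eq_iff_eq] at this
    exact eq_of_heq (Sigma.mk.inj_iff.1 this).2
  rw [← (e i).symm_symm, hsymm, Equiv.symm_symm]

/-- Every ordered partition into small blocks refines a partition into large blocks, the unions of
the small ones. -/
theorem exists_refineEquiv_eq (e₀ : Fin n ≃ Σ i, Fin (a i)) (h : ∀ i, ∑ j, l i j = L i)
    {f : Fin d ≃ Σ t : Fin n, Fin (l (e₀ t).1 (e₀ t).2)} (hf : IsShuffle f) :
    ∃ (E : Fin d ≃ Σ i, Fin (L i)) (e : ∀ i, Fin (L i) ≃ Σ j, Fin (l i j)),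
      IsShuffle E ∧ (∀ i, IsShuffle (e i)) ∧ refineEquiv e₀ e E = f := by
  -- `f`, with the small blocks grouped into large ones
  let g : Fin d ≃ Σ i, Σ j, Fin (l i j) :=
    (f.trans (Equiv.sigmaCongrLeft (β := fun x : Σ i, Fin (a i) => Fin (l x.1 x.2)) e₀)).trans
      (Equiv.sigmaAssoc fun i (j : Fin (a i)) => Fin (l i j))
  have hg (t : Fin n) (s : Fin (l (e₀ t).1 (e₀ t).2)) :
      g.symm ⟨(e₀ t).1, (e₀ t).2, s⟩ = f.symm ⟨t, s⟩ := by
    rw [Equiv.symm_apply_eq]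
    simp only [g, Equiv.trans_apply, Equiv.apply_symm_apply]
    rfl
  -- the large block `i`, as a set, is the disjoint union of the small blocks in it
  let v (i : Fin k) : {t // (g t).1 = i} ≃ Σ j, Fin (l i j) :=
    (g.subtypeEquiv fun _ => Iff.rfl).trans (Equiv.sigmaSubtype i)
  obtain ⟨E, hE, hEg⟩ := exists_isShuffle_fst_eq (l := L) (fun t => (g t).1) fun i => by
    rw [Fintype.card_congr (v i), Fintype.card_sigma, ← h i]
    simp only [Fintype.card_fin]
  let w (i : Fin k) : Fin (L i) ≃ {t // (g t).1 = i} :=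
    ((E.subtypeEquiv fun t => by rw [hEg]).trans (Equiv.sigmaSubtype i)).symm
  have hv (i : Fin k) (y : Σ j, Fin (l i j)) : ((v i).symm y : Fin d) = g.symm ⟨i, y⟩ := rfl
  have hw (i : Fin k) (y) : E.symm ⟨i, (w i).symm y⟩ = y := congrArg Subtype.val
    ((w i).apply_symm_apply y)
  refine ⟨E, fun i => (w i).trans (v i), hE, fun i j s s' hs => ?_, ?_⟩
  · obtain ⟨t, ht⟩ := e₀.surjective ⟨i, j⟩
    obtain rfl : (e₀ t).1 = i := by rw [ht]
    obtain rfl : (e₀ t).2 = j := eq_of_heq (Sigma.mk.inj_iff.1 ht).2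
    refine (hE (e₀ t).1).lt_iff_lt.1 ?_
    simp only [Equiv.symm_trans_apply, hw, hv, hg]
    exact hf t hs
  · have hsymm : (refineEquiv e₀ (fun i => (w i).trans (v i)) E).symm = f.symm := by
      ext1 ⟨t, s⟩
      rw [refineEquiv_symm_apply, Equiv.symm_trans_apply, hw, hv, hg]
    rw [← Equiv.symm_symm (refineEquiv _ _ _), hsymm, Equiv.symm_symm]

open Classical in
/-- A sum over all partitions into small blocks is the sum, over all partitions into large blocks
and all partitions of the large blocks, of the values at the refinements. -/
theorem sum_shuffle_refineEquiv {V : Type*} [AddCommMonoid V] (e₀ : Fin n ≃ Σ i, Fin (a i))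
    (h : ∀ i, ∑ j, l i j = L i) (F : (Fin d ≃ Σ t : Fin n, Fin (l (e₀ t).1 (e₀ t).2)) → V) :
    (∑ E : Fin d ≃ Σ i, Fin (L i) with IsShuffle E,
      ∑ e ∈ Fintype.piFinset fun i =>
        {e : Fin (L i) ≃ Σ j, Fin (l i j) | IsShuffle e}, F (refineEquiv e₀ e E)) =
      ∑ f : Fin d ≃ Σ t : Fin n, Fin (l (e₀ t).1 (e₀ t).2) with IsShuffle f, F f := by
  rw [← Finset.sum_product']
  refine Finset.sum_bij (fun x _ => refineEquiv e₀ x.2 x.1) ?_ ?_ ?_ fun _ _ => rfl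
  · rintro ⟨E, e⟩ hx
    simp only [Finset.mem_product, Finset.mem_filter_univ, Fintype.mem_piFinset] at hx ⊢
    exact IsShuffle.refineEquiv e₀ hx.2 hx.1
  · rintro ⟨E, e⟩ hx ⟨E', e'⟩ hx' hEe
    simp only [Finset.mem_product, Finset.mem_filter_univ] at hx hx'
    obtain ⟨rfl, rfl⟩ := refineEquiv_injective_of_isShuffle e₀ hx.1 hx'.1 hEe
    rfl
  · intro f hf
    obtain ⟨E, e, hE, he, rfl⟩ := exists_refineEquiv_eq e₀ h (Finset.mem_filter_univ f |>.1 hf)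
    refine ⟨(E, e), ?_, rfl⟩
    simp only [Finset.mem_product, Finset.mem_filter_univ, Fintype.mem_piFinset]
    exact ⟨hE, he⟩

end Refine

/-! ### The symmetrized product -/

section SymProd

variable {𝕜 : Type u} [Field 𝕜] {P : SMod.{u, v} 𝕜} {M : SMod.{u, w} 𝕜}

/-- The class of `p ⊗ m₁ ⊗ … ⊗ m_k ⊗ e`, as a multilinear map in `m₁, …, m_k`. -/
noncomputable def PlethObj.mkMultilinear {n k : ℕ} (l : Fin k → ℕ) (e : Fin n ≃ Σ i, Fin (l i))
    (p : P.obj k) : MultilinearMap 𝕜 (fun i => M.obj (l i)) (PlethObj P M n) :=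
  ((plethRel P M n).mkQ ∘ₗ
    DirectSum.lof 𝕜 (PlethIdx n) (fun x => P.obj x.1 ⊗[𝕜] (⨂[𝕜] i, M.obj (x.2.1 i))) ⟨k, l, e⟩ ∘ₗ
      TensorProduct.mk 𝕜 (P.obj k) (⨂[𝕜] i, M.obj (l i)) p).compMultilinearMap
    (PiTensorProduct.tprod 𝕜)

theorem PlethObj.mkMultilinear_apply {n k : ℕ} (l : Fin k → ℕ) (e : Fin n ≃ Σ i, Fin (l i))
    (p : P.obj k) (m : ∀ i, M.obj (l i)) :
    PlethObj.mkMultilinear l e p m = PlethObj.mk l e p m :=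
  rfl

open Classical in
theorem SMod.symProd_mk (μ : SMod.Hom (P.pleth M) M) {n k : ℕ} (l : Fin k → ℕ)
    (h : ∑ i, l i = n) (p : P.obj k) (m : ∀ i, M.obj (l i)) :
    SMod.symProd μ n (GrPlethObj.mk (A := M.toGrVect) l h p m) =
      ∑ e : Fin n ≃ Σ i, Fin (l i) with IsShuffle e, μ.toFun n (PlethObj.mk l e p m) := by
  have hpsi : P.psi M n (GrPlethObj.mk (A := M.toGrVect) l h p m) =
      ∑ e : Fin n ≃ Σ i, Fin (l i) with IsShuffle e, PlethObj.mk l e p m :=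
    prePsi_gen l h p m
  exact (congrArg (μ.toFun n) hpsi).trans (map_sum (μ.toFun n) _ _)

theorem SMod.Hom.toFun_mk_trans (μ : SMod.Hom (P.pleth M) M) {n k : ℕ} (l : Fin k → ℕ)
    (τ : Equiv.Perm (Fin n)) (e : Fin n ≃ Σ i, Fin (l i)) (p : P.obj k) (m : ∀ i, M.obj (l i)) :
    μ.toFun n (PlethObj.mk l (τ.trans e) p m) = M.act τ (μ.toFun n (PlethObj.mk l e p m)) := by
  rw [← PlethObj.act_mk]
  exact μ.equivariant n τ (PlethObj.mk l e p m)

theorem SMod.symProd_mk_eq_shuffleSum (μ : SMod.Hom (P.pleth M) M) {k : ℕ} (l : Fin k → ℕ)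
    (p : P.obj k) (m : ∀ i, M.obj (l i)) :
    SMod.symProd μ (∑ i, l i) (GrPlethObj.mk (A := M.toGrVect) l rfl p m) =
      (M.ρ (∑ i, l i)).asAlgebraHom (shuffleSum 𝕜 l)
        (μ.toFun (∑ i, l i) (PlethObj.mk l (blocks l) p m)) := by
  classical
  rw [SMod.symProd_mk, shuffleSum, map_sum, LinearMap.sum_apply]
  symm
  refine Finset.sum_equiv ((Equiv.refl _).equivCongr (blocks l)) (fun τ => ?_) fun τ _ => ?_
  · simp only [Finset.mem_filter_univ]
    rfl
  · rw [Representation.asAlgebraHom_of]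
    exact (SMod.Hom.toFun_mk_trans μ l τ (blocks l) p m).symm

theorem SMod.symProd_assoc {mul : SMod.Hom (P.pleth P) P} {μ : SMod.Hom (P.pleth M) M}
    (hμ : SMod.ActAssoc mul μ) {k n d : ℕ} (a : Fin k → ℕ) (L : Fin k → ℕ)
    (l : ∀ i, Fin (a i) → ℕ) (e₀ : Fin n ≃ Σ i, Fin (a i)) (h : ∀ i, ∑ j, l i j = L i)
    (H : ∑ i, L i = d) (H' : ∑ t : Fin n, l (e₀ t).1 (e₀ t).2 = d)
    (p : P.obj k) (q : ∀ i, P.obj (a i)) (x : ∀ i j, M.obj (l i j)) :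
    SMod.symProd μ d (GrPlethObj.mk (A := M.toGrVect) L H p fun i =>
        SMod.symProd μ (L i) (GrPlethObj.mk (A := M.toGrVect) (l i) (h i) (q i) (x i))) =
      SMod.symProd μ d (GrPlethObj.mk (A := M.toGrVect) (fun t => l (e₀ t).1 (e₀ t).2) H'
        (mul.toFun n (PlethObj.mk a e₀ p q)) fun t => x (e₀ t).1 (e₀ t).2) := by
  classical
  simp only [SMod.symProd_mk]
  rw [← sum_shuffle_refineEquiv e₀ h]
  refine Finset.sum_congr rfl fun E _ => ?_
  rw [← PlethObj.mkMultilinear_apply, MultilinearMap.map_sum_finset]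
  refine (map_sum (μ.toFun d) _ _).trans (Finset.sum_congr rfl fun e _ => ?_)
  exact hμ k n d a L l e₀ e E p q x

theorem SMod.symProd_unit {one : P.obj 1} {μ : SMod.Hom (P.pleth M) M}
    (hμ : SMod.ActUnit one μ) (n : ℕ) (x : M.obj n) :
    SMod.symProd μ n (GrPlethObj.mk (A := M.toGrVect) (fun _ : Fin 1 => n)
      (Fin.sum_univ_one _) one fun _ => x) = x := by
  classical
  have hid : IsShuffle (Equiv.uniqueSigma fun _ : Fin 1 => Fin n).symm := fun i => by
    obtain rfl := Subsingleton.elim i default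
    exact strictMono_id
  rw [SMod.symProd_mk, Finset.sum_eq_single_of_mem _ ((Finset.mem_filter_univ _).2 hid)]
  · exact hμ n x
  · intro e he hne
    exact absurd (((Finset.mem_filter_univ _).1 he).eq_of_fst_eq hid
      fun _ => Subsingleton.elim _ _) hne

end SymProd

theorem theorem2p3p1 {𝕜 : Type u} [Field 𝕜] (P : Operad.{u, v} 𝕜) (M : SMod.{u, w} 𝕜)
    (μ : SMod.Hom (P.toSMod.pleth M) M) (hμ : P.IsSAlgebra M μ) :
    P.IsGrAlgebra M.toGrVect (SMod.symProd μ) ∧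
      ∀ (k : ℕ) (l : Fin k → ℕ) (p : P.obj k) (m : ∀ i, M.obj (l i)),
        SMod.symProd μ (∑ i, l i) (GrPlethObj.mk l rfl p m) =
          (M.ρ (∑ i, l i)).asAlgebraHom (shuffleSum 𝕜 l)
            (μ.toFun (∑ i, l i) (PlethObj.mk l (blocks l) p m)) :=
  ⟨⟨fun _ _ _ a L l e₀ h H H' p q x => SMod.symProd_assoc hμ.assoc a L l e₀ h H H' p q x,
      SMod.symProd_unit hμ.unit⟩,
    fun _ => SMod.symProd_mk_eq_shuffleSum μ⟩
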